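/- For a two-qubit operator $U$ acting on $\mathcal{H}_A\otimes\mathcal{H}_B$, with $\mathcal{H}_A=\mathcal{H}_B=\mathbb{C}^2$, let $|\Psi_U\rangle = U\,(|\Phi\rangle_{AA'}\otimes|\Phi\rangle_{BB'})$, where $|\Phi\rangle=\frac{1}{\sqrt2}\sum_{k=0}^{1}|k\rangle|k\rangle$ and $U$ acts on the systems $A$ and $B$. The Schmidt coefficients of $U$ are the Schmidt coefficients of $|\Psi_U\rangle$ with respect to the partition between $AA'$ and $BB'$, that is, the four numbers $s_0,s_1,s_2,s_3\ge 0$ in a decomposition $|\Psi_U\rangle=\sum_{j=0}^{3}s_j\,|e_j\rangle_{AA'}\otimes|f_j\rangle_{BB'}$ with orthonormal families $(e_j)$ and $(f_j)$. Suppose $U$ and $U'$ are two two-qubit unitary operators that have the same Schmidt coefficients $s_0,s_1,s_2,s_3$, which satisfy $s_0>s_1\ge s_2\ge s_3$. Then $U'$ is equivalent to $U$ or to $U^*$ under local unitary transformations, where $U^*$ is the entrywise complex conjugate of $U$ in the computational basis. In other words, $$U'=(V_A\otimes W_B)\,\tilde U\,(\tilde V_A\otimes\tilde W_B),$$ where $\tilde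 U=U$ or $\tilde U=U^*$, and $V_A,W_B,\tilde V_A,\tilde W_B$ are suitable unitary operators on one qubit. -/

import Mathlib

open scoped Kronecker

noncomputable section

/-- `IsSchmidtCoeffs ψ s`: the numbers `s j`, listed with multiplicity and in some order, are the
Schmidt coefficients of the bipartite vector `ψ ∈ ℂ^A ⊗ ℂ^B`. That is, `s` has
`min (dim A) (dim B)` nonnegative entries and `ψ = ∑ j, s j • (e j ⊗ f j)` for some orthonormal
families `e` in `ℂ^A` and `f` in `ℂ^B`. -/
def IsSchmidtCoeffs {A B : Type} [Fintype A] [Fintype B] {r : ℕ}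
    (ψ : EuclideanSpace ℂ (A × B)) (s : Fin r → ℝ) : Prop :=
  r = min (Fintype.card A) (Fintype.card B) ∧
  (∀ j, 0 ≤ s j) ∧
  ∃ (e : Fin r → EuclideanSpace ℂ A) (f : Fin r → EuclideanSpace ℂ B),
    Orthonormal ℂ e ∧ Orthonormal ℂ f ∧
      ∀ a b, ψ (a, b) = ∑ j, (s j : ℂ) * (e j a * f j b)

/-- Operators on two qubits, as matrices in the computational basis `|a⟩ ⊗ |b⟩`. -/
abbrev TwoQubitOp : Type := Matrix (Fin 2 × Fin 2) (Fin 2 × Fin 2) ℂ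

/-- The maximally entangled two-qubit state `(1/√2) ∑ k, |k⟩|k⟩`. -/
def maxEntangled : EuclideanSpace ℂ (Fin 2 × Fin 2) :=
  WithLp.toLp 2 fun p => if p.1 = p.2 then ((1 / Real.sqrt 2 : ℝ) : ℂ) else 0

/-- The Choi state `U (|Φ⟩_{AA'} ⊗ |Φ⟩_{BB'})`, where `U` acts on `A` and `B`, as a vector of
the bipartite space `AA' ⊗ BB'`; its coordinates are indexed by `((a, a'), (b, b'))`. -/
def choiState (U : TwoQubitOp) :
    EuclideanSpace ℂ ((Fin 2 × Fin 2) × (Fin 2 × Fin 2)) :=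
  WithLp.toLp 2 fun p =>
    ∑ c : Fin 2, ∑ d : Fin 2,
      U (p.1.1, p.2.1) (c, d) * (maxEntangled (c, p.1.2) * maxEntangled (d, p.2.2))

/-- The Schmidt coefficients of a two-qubit operator are those of its Choi state with respect to
the partition between `AA'` and `BB'`. -/
def HasSchmidtCoeffs (U : TwoQubitOp) (s : Fin 4 → ℝ) : Prop :=
  IsSchmidtCoeffs (choiState U) s

/-- `U'` is equivalent to `U` under local unitary transformations (before and after `U`). -/
def LocallyEquivalent (U' U : TwoQubitOp) : Prop :=
  ∃ V ∈ Matrix.unitaryGroup (Fin 2) ℂ, ∃ W ∈ Matrix.unitaryGroup (Fin 2) ℂ,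
  ∃ V' ∈ Matrix.unitaryGroup (Fin 2) ℂ, ∃ W' ∈ Matrix.unitaryGroup (Fin 2) ℂ,
    U' = (V ⊗ₖ W) * U * (V' ⊗ₖ W')

end

open scoped Quaternion in
theorem quaternion_reflection_apply (v x : ℍ) (hv : ‖v‖ = 1) :
    (ℝ ∙ v)ᗮ.reflection x = -(v * star x * v) := by
  have h1 : v.re ^ 2 + v.imI ^ 2 + v.imJ ^ 2 + v.imK ^ 2 = 1 := by
    rw [← Quaternion.normSq_def', Quaternion.normSq_eq_norm_mul_self, hv, one_mul]
  rw [Submodule.reflection_orthogonal_apply, Submodule.reflection_singleton_apply, hv]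
  congr 1
  have h2 : inner ℝ v x = v.re * x.re + v.imI * x.imI + v.imJ * x.imJ + v.imK * x.imK := by
    rw [Quaternion.inner_def]; simp
  rw [h2, two_smul]
  ext
  · simp; linear_combination x.re * h1
  · simp; linear_combination x.imI * h1
  · simp; linear_combination x.imJ * h1
  · simp; linear_combination x.imK * h1

open scoped Quaternion in
theorem quaternion_isometry_eq (φ : ℍ ≃ₗᵢ[ℝ] ℍ) :
    ∃ p q : ℍ, ‖p‖ = 1 ∧ ‖q‖ = 1 ∧
      ((∀ x, φ x = p * x * q) ∨ ∀ x, φ x = p * star x * q) := by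
  obtain ⟨l, -, rfl⟩ := φ.reflections_generate_dim
  induction l with
  | nil => exact ⟨1, 1, by simp, by simp, Or.inl fun x => by simp⟩
  | cons v l ih =>
    obtain ⟨p, q, hp, hq, h⟩ := ih
    simp only [List.map_cons, List.prod_cons, LinearIsometryEquiv.coe_mul, Function.comp_apply]
    by_cases hv : v = 0
    · subst hv
      refine ⟨p, q, hp, hq, ?_⟩
      simp only [Submodule.reflection_orthogonal_apply, Submodule.reflection_singleton_apply,
        smul_zero, zero_sub, neg_neg]
      exact h
    · set w : ℍ := (‖v‖⁻¹ : ℝ) • v with hw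
      have hn : ‖v‖ ≠ 0 := norm_ne_zero_iff.mpr hv
      have hw1 : ‖w‖ = 1 := by rw [hw, norm_smul]; simp [hn]
      have hspan : (ℝ ∙ v) = (ℝ ∙ w) :=
        (Submodule.span_singleton_smul_eq (IsUnit.mk0 _ (inv_ne_zero hn)) v).symm
      have key : ∀ x, (ℝ ∙ v)ᗮ.reflection x = -(w * star x * w) := fun x => by
        rw [← quaternion_reflection_apply w x hw1]
        simp only [hspan]
      refine ⟨-(w * star q), star p * w, ?_, ?_, ?_⟩
      · simp [hw1, hq]
      · simp [hw1, hp]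
      · rcases h with h | h
        · right; intro x; rw [key, h]; simp [mul_assoc]
        · left; intro x; rw [key, h]; simp [mul_assoc]

section

open scoped Quaternion

/-- The embedding of the quaternions into the complex `2 × 2` matrices. -/
def quatMatrix (x : ℍ) : Matrix (Fin 2) (Fin 2) ℂ :=
  !![⟨x.re, x.imI⟩, ⟨x.imJ, x.imK⟩; ⟨-x.imJ, x.imK⟩, ⟨x.re, -x.imI⟩]

theorem quatMatrix_mul (x y : ℍ) : quatMatrix (x * y) = quatMatrix x * quatMatrix y := by
  ext i j
  fin_cases i <;> fin_cases j <;>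
    simp [quatMatrix, Matrix.mul_apply, Fin.sum_univ_two, Complex.ext_iff] <;>
    constructor <;> ring

theorem quatMatrix_star (x : ℍ) : quatMatrix (star x) = star (quatMatrix x) := by
  ext i j
  fin_cases i <;> fin_cases j <;> simp [quatMatrix, Complex.ext_iff]

theorem quatMatrix_one : quatMatrix 1 = 1 := by
  ext i j
  fin_cases i <;> fin_cases j <;> simp [quatMatrix, Complex.ext_iff]

theorem quatMatrix_mem_unitaryGroup {x : ℍ} (hx : ‖x‖ = 1) :
    quatMatrix x ∈ Matrix.unitaryGroup (Fin 2) ℂ := by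
  rw [Matrix.mem_unitaryGroup_iff, ← quatMatrix_star, ← quatMatrix_mul, Quaternion.self_mul_star,
    Quaternion.normSq_eq_norm_mul_self, hx, one_mul, Quaternion.coe_one, quatMatrix_one]

theorem transpose_mem_unitaryGroup {n : Type*} [Fintype n] [DecidableEq n] {V : Matrix n n ℂ}
    (hV : V ∈ Matrix.unitaryGroup n ℂ) : V.transpose ∈ Matrix.unitaryGroup n ℂ := by
  rw [Matrix.mem_unitaryGroup_iff, Matrix.star_eq_conjTranspose] at *
  have := congrArg Matrix.transpose (mul_eq_one_comm.mp hV)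
  rw [Matrix.transpose_mul, Matrix.transpose_one] at this
  exact this

/-- The quaternion units `1, i, j, k`. -/
def quatUnit : Fin 4 → ℍ := ![⟨1, 0, 0, 0⟩, ⟨0, 1, 0, 0⟩, ⟨0, 0, 1, 0⟩, ⟨0, 0, 0, 1⟩]

/-- The (unnormalised) magic basis of two qubits, as the columns of a matrix. -/
def magic : Matrix (Fin 2 × Fin 2) (Fin 4) ℂ :=
  Matrix.of fun p k => quatMatrix (quatUnit k) p.1 p.2

theorem magic_mul_conjTranspose : magic * magic.conjTranspose = (2 : ℂ) • 1 := by
  ext ⟨i, i'⟩ ⟨j, j'⟩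
  fin_cases i <;> fin_cases i' <;> fin_cases j <;> fin_cases j' <;>
    simp [magic, quatMatrix, quatUnit, Matrix.mul_apply, Fin.sum_univ_four, Complex.ext_iff] <;>
    norm_num

theorem conjTranspose_mul_magic : magic.conjTranspose * magic = (2 : ℂ) • 1 := by
  ext i j
  fin_cases i <;> fin_cases j <;>
    simp [magic, quatMatrix, quatUnit, Matrix.mul_apply, Fintype.sum_prod_type, Fin.sum_univ_two,
      Complex.ext_iff] <;>
    norm_num

theorem quaternion_tuple_apply (x : ℍ) :
    Quaternion.linearIsometryEquivTuple x = !₂[x.re, x.imI, x.imJ, x.imK] := rfl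

theorem quatMatrix_eq_sum (x : ℍ) (a b : Fin 2) :
    quatMatrix x a b = ∑ i, magic (a, b) i * (Quaternion.linearIsometryEquivTuple x i : ℂ) := by
  rw [quaternion_tuple_apply]
  fin_cases a <;> fin_cases b <;>
    simp [magic, quatMatrix, quatUnit, Fin.sum_univ_four, Complex.ext_iff]

/-- In the magic basis, a real orthogonal matrix is a local unitary up to a reflection which is
diagonal in this basis. -/
theorem magic_mul_orthogonal (O : Matrix (Fin 4) (Fin 4) ℝ) (hO : O.transpose * O = 1) :
    ∃ V ∈ Matrix.unitaryGroup (Fin 2) ℂ, ∃ W ∈ Matrix.unitaryGroup (Fin 2) ℂ,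
      ∃ d : Fin 4 → ℂ, (∀ k, d k * d k = 1) ∧ (∀ k, star (d k) = d k) ∧
        magic * O.map Complex.ofReal = (V ⊗ₖ W) * magic * Matrix.diagonal d := by
  let T : EuclideanSpace ℝ (Fin 4) →ₗ[ℝ] EuclideanSpace ℝ (Fin 4) := Matrix.toEuclideanLin O
  have hT : ∀ x y, inner ℝ (T x) (T y) = inner ℝ x y := fun x y => by
    simp only [T, Matrix.toLpLin_apply, EuclideanSpace.inner_eq_star_dotProduct, star_trivial]
    rw [Matrix.dotProduct_mulVec, Matrix.vecMul_mulVec, hO, Matrix.vecMul_one]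
  let ψ := (T.isometryOfInner hT).toLinearIsometryEquiv rfl
  let L := Quaternion.linearIsometryEquivTuple
  let φ : ℍ ≃ₗᵢ[ℝ] ℍ := (L.trans ψ).trans L.symm
  have hunit : ∀ j, L (quatUnit j) = EuclideanSpace.single j (1 : ℝ) := fun j => by
    ext i
    change (Quaternion.linearIsometryEquivTuple (quatUnit j)).ofLp i = _
    rw [quaternion_tuple_apply]
    fin_cases j <;> fin_cases i <;> simp [quatUnit]
  have hφ : ∀ i j, L (φ (quatUnit j)) i = O i j := fun i j => by
    have : L (φ (quatUnit j)) = T (L (quatUnit j)) := by simp [φ, ψ]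
    rw [this, hunit]
    simp [T, Matrix.toLpLin_apply]
  have hcol : ∀ a b j, (magic * O.map Complex.ofReal) (a, b) j
      = quatMatrix (φ (quatUnit j)) a b := fun a b j => by
    rw [quatMatrix_eq_sum]
    simp only [Matrix.mul_apply, Matrix.map_apply]
    simp only [← hφ, L]
  have hloc : ∀ p x q a b, quatMatrix (p * x * q) a b
      = ∑ c : Fin 2 × Fin 2, (quatMatrix p ⊗ₖ (quatMatrix q).transpose) (a, b) c
          * quatMatrix x c.1 c.2 := fun p x q a b => by
    simp only [quatMatrix_mul, Matrix.mul_apply, Fintype.sum_prod_type, Fin.sum_univ_two,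
      Matrix.kroneckerMap_apply, Matrix.transpose_apply]
    ring
  obtain ⟨p, q, hp, hq, h | h⟩ := quaternion_isometry_eq φ
  · refine ⟨_, quatMatrix_mem_unitaryGroup hp, _,
      transpose_mem_unitaryGroup (quatMatrix_mem_unitaryGroup hq), fun _ => 1, by simp, by simp, ?_⟩
    ext ⟨a, b⟩ j
    rw [hcol, h, hloc, Matrix.mul_diagonal, mul_one, Matrix.mul_apply]
    rfl
  · refine ⟨_, quatMatrix_mem_unitaryGroup hp, _,
      transpose_mem_unitaryGroup (quatMatrix_mem_unitaryGroup hq), ![1, -1, -1, -1], ?_, ?_, ?_⟩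
    · intro k; fin_cases k <;> simp
    · intro k; fin_cases k <;> simp
    · have hstar : ∀ j (c : Fin 2 × Fin 2), quatMatrix (star (quatUnit j)) c.1 c.2
          = magic c j * (![1, -1, -1, -1] : Fin 4 → ℂ) j := by
        rintro j ⟨c, d⟩
        rw [quatMatrix_star]
        fin_cases j <;> fin_cases c <;> fin_cases d <;>
          simp [magic, quatMatrix, quatUnit, Complex.ext_iff]
      ext ⟨a, b⟩ j
      rw [hcol, h, hloc, Matrix.mul_diagonal]
      simp only [hstar, Matrix.mul_apply, Finset.sum_mul, mul_assoc]

end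

theorem exists_perm_of_map_univ_eq {ι α : Type*} [Fintype ι] [DecidableEq α] (f g : ι → α)
    (h : Finset.univ.val.map f = Finset.univ.val.map g) : ∃ σ : Equiv.Perm ι, ∀ i, f i = g (σ i) := by
  classical
  have hc : ∀ c, Nonempty ({a // f a = c} ≃ {b // g b = c}) := fun c => by
    rw [← Fintype.card_eq, Fintype.card_subtype, Fintype.card_subtype]
    have := congrArg (Multiset.count c) h
    rw [Multiset.count_map, Multiset.count_map] at this
    simpa [Finset.card_def, eq_comm] using this
  have e := fun c => (hc c).some
  exact ⟨Equiv.ofFiberEquiv e, fun i => (Equiv.ofFiberEquiv_map e i).symm⟩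

/-- Two commuting real symmetric matrices have a common orthonormal eigenbasis. -/
theorem exists_orthogonal_diagonalizing {n : ℕ} (A B : Matrix (Fin n) (Fin n) ℝ)
    (hA : A.IsHermitian) (hB : B.IsHermitian) (hAB : A * B = B * A) :
    ∃ O : Matrix (Fin n) (Fin n) ℝ, ∃ a b : Fin n → ℝ, O.transpose * O = 1 ∧
      A * O = O * Matrix.diagonal a ∧ B * O = O * Matrix.diagonal b := by
  classical
  let S := Matrix.toEuclideanLin A
  let T := Matrix.toEuclideanLin B
  have hS : S.IsSymmetric := Matrix.isSymmetric_toEuclideanLin_iff.mpr hA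
  have hT : T.IsSymmetric := Matrix.isSymmetric_toEuclideanLin_iff.mpr hB
  have hST : Commute S T := by
    apply LinearMap.ext
    intro x
    simp [S, T, Matrix.toLpLin_apply, hAB]
  let V : Module.End.Eigenvalues T × Module.End.Eigenvalues S →
      Submodule ℝ (EuclideanSpace ℝ (Fin n)) :=
    fun i => Module.End.eigenspace S i.2 ⊓ Module.End.eigenspace T i.1
  have hV : OrthogonalFamily ℝ (fun i => V i) fun i => (V i).subtypeₗᵢ :=
    (LinearMap.IsSymmetric.orthogonalFamily_eigenspace_inf_eigenspace hS hT).comp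
      (γ := Module.End.Eigenvalues T × Module.End.Eigenvalues S)
      (f := fun i => ((i.1 : ℝ), (i.2 : ℝ))) (by
        rintro ⟨i, j⟩ ⟨i', j'⟩ h
        simp only [Prod.mk.injEq] at h
        exact Prod.ext (Subtype.ext h.1) (Subtype.ext h.2))
  have hint : DirectSum.IsInternal V := by
    rw [hV.isInternal_iff, Submodule.orthogonal_eq_bot_iff, eq_top_iff,
      ← LinearMap.IsSymmetric.iSup_iSup_eigenspace_inf_eigenspace_eq_top_of_commute hS hT hST]
    refine iSup_le fun α => iSup_le fun γ => ?_
    by_cases h : Module.End.HasEigenvalue S α ∧ Module.End.HasEigenvalue T γ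
    · exact le_iSup V (⟨γ, h.2⟩, ⟨α, h.1⟩)
    · rw [not_and_or] at h
      rcases h with h | h <;> rw [Module.End.hasEigenvalue_iff, not_not] at h <;> simp [h]
  obtain ⟨b, hb⟩ : ∃ b : OrthonormalBasis (Fin n) ℝ (EuclideanSpace ℝ (Fin n)),
      ∀ j, ∃ α β : ℝ, S (b j) = α • b j ∧ T (b j) = β • b j := by
    refine ⟨hint.subordinateOrthonormalBasis (n := n) (by simp) hV, fun j => ?_⟩
    have := hint.subordinateOrthonormalBasis_subordinate (n := n) (by simp) j hV
    exact ⟨_, _, Module.End.mem_eigenspace_iff.mp this.1, Module.End.mem_eigenspace_iff.mp this.2⟩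
  choose α β hα hβ using hb
  clear hint hV
  refine ⟨Matrix.of fun i j => b j i, α, β, ?_, ?_, ?_⟩
  · ext i j
    have := orthonormal_iff_ite.mp b.orthonormal i j
    rw [Matrix.one_apply, ← this, EuclideanSpace.inner_eq_star_dotProduct]
    simp only [Matrix.mul_apply, dotProduct, Matrix.transpose_apply, Matrix.of_apply, star_trivial]
    exact Finset.sum_congr rfl fun _ _ => mul_comm _ _
  · ext i j
    have := congrArg (fun v : EuclideanSpace ℝ (Fin n) => v i) (hα j)
    simp only [S, Matrix.toLpLin_apply, PiLp.smul_apply, smul_eq_mul] at this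
    rw [Matrix.mul_diagonal, Matrix.of_apply, mul_comm, ← this]
    rfl
  · ext i j
    have := congrArg (fun v : EuclideanSpace ℝ (Fin n) => v i) (hβ j)
    simp only [T, Matrix.toLpLin_apply, PiLp.smul_apply, smul_eq_mul] at this
    rw [Matrix.mul_diagonal, Matrix.of_apply, mul_comm, ← this]
    rfl

open Matrix in
/-- The operator that is diagonal in the magic basis, with eigenvalues `l`. -/
noncomputable def magicDiag (l : Fin 4 → ℂ) : TwoQubitOp :=
  (1 / 2 : ℂ) • (magic * diagonal l * magicᴴ)

theorem star_kronecker_mul_self {V W : Matrix (Fin 2) (Fin 2) ℂ}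
    (hV : V ∈ Matrix.unitaryGroup (Fin 2) ℂ) (hW : W ∈ Matrix.unitaryGroup (Fin 2) ℂ) :
    (star V ⊗ₖ star W) * (V ⊗ₖ W) = 1 := by
  rw [← Matrix.mul_kronecker_mul, Matrix.mem_unitaryGroup_iff'.mp hV,
    Matrix.mem_unitaryGroup_iff'.mp hW, Matrix.one_kronecker_one]

theorem kronecker_mul_star_self {V W : Matrix (Fin 2) (Fin 2) ℂ}
    (hV : V ∈ Matrix.unitaryGroup (Fin 2) ℂ) (hW : W ∈ Matrix.unitaryGroup (Fin 2) ℂ) :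
    (V ⊗ₖ W) * (star V ⊗ₖ star W) = 1 := by
  rw [← Matrix.mul_kronecker_mul, Matrix.mem_unitaryGroup_iff.mp hV,
    Matrix.mem_unitaryGroup_iff.mp hW, Matrix.one_kronecker_one]

theorem LocallyEquivalent.symm {U U' : TwoQubitOp} (h : LocallyEquivalent U' U) :
    LocallyEquivalent U U' := by
  obtain ⟨V, hV, W, hW, V', hV', W', hW', rfl⟩ := h
  refine ⟨star V, Unitary.star_mem hV, star W, Unitary.star_mem hW, star V', Unitary.star_mem hV',
    star W', Unitary.star_mem hW', ?_⟩
  calc U = ((star V ⊗ₖ star W) * (V ⊗ₖ W)) * U * ((V' ⊗ₖ W') * (star V' ⊗ₖ star W')) := by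
        rw [star_kronecker_mul_self hV hW, kronecker_mul_star_self hV' hW', one_mul, mul_one]
    _ = _ := by simp only [mul_assoc]

theorem LocallyEquivalent.trans {U U' U'' : TwoQubitOp} (h : LocallyEquivalent U U')
    (h' : LocallyEquivalent U' U'') : LocallyEquivalent U U'' := by
  obtain ⟨V, hV, W, hW, V', hV', W', hW', rfl⟩ := h
  obtain ⟨X, hX, Y, hY, X', hX', Y', hY', rfl⟩ := h'
  refine ⟨V * X, mul_mem hV hX, W * Y, mul_mem hW hY, X' * V', mul_mem hX' hV',
    Y' * W', mul_mem hY' hW', ?_⟩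
  rw [Matrix.mul_kronecker_mul, Matrix.mul_kronecker_mul]
  simp only [mul_assoc]

theorem map_conj_mem_unitaryGroup {V : Matrix (Fin 2) (Fin 2) ℂ}
    (hV : V ∈ Matrix.unitaryGroup (Fin 2) ℂ) :
    V.map (starRingEnd ℂ) ∈ Matrix.unitaryGroup (Fin 2) ℂ :=
  transpose_mem_unitaryGroup (Unitary.star_mem hV)

theorem LocallyEquivalent.conj {U U' : TwoQubitOp} (h : LocallyEquivalent U' U) :
    LocallyEquivalent (U'.map (starRingEnd ℂ)) (U.map (starRingEnd ℂ)) := by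
  obtain ⟨V, hV, W, hW, V', hV', W', hW', rfl⟩ := h
  refine ⟨_, map_conj_mem_unitaryGroup hV, _, map_conj_mem_unitaryGroup hW, _,
    map_conj_mem_unitaryGroup hV', _, map_conj_mem_unitaryGroup hW', ?_⟩
  rw [Matrix.map_mul, Matrix.map_mul]
  congr 2
  · ext i j; simp
  · ext i j; simp

open Matrix in
theorem commute_re_im_of_symmetric_unitary {n : ℕ} {m : Matrix (Fin n) (Fin n) ℂ} (hs : mᵀ = m)
    (hu : m * mᴴ = 1) :
    m.map Complex.re * m.map Complex.im = m.map Complex.im * m.map Complex.re := by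
  ext i j
  have hs' : ∀ i j, m i j = m j i := fun i j => congrFun (congrFun hs j) i
  have h := congrArg Complex.im (congrFun (congrFun hu i) j)
  have h1 : ((1 : Matrix (Fin n) (Fin n) ℂ) i j).im = 0 := by
    rw [Matrix.one_apply]; split_ifs <;> simp
  rw [h1, Matrix.mul_apply, Complex.im_sum] at h
  simp only [Matrix.mul_apply, Matrix.map_apply]
  rw [← sub_eq_zero, ← Finset.sum_sub_distrib, ← neg_eq_zero, ← Finset.sum_neg_distrib, ← h]
  refine Finset.sum_congr rfl fun k _ => ?_
  rw [Matrix.conjTranspose_apply, hs' j k]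
  simp
  ring

open Matrix in
/-- The Cartan decomposition of the two-qubit unitaries. -/
theorem exists_locallyEquivalent_magicDiag (U : TwoQubitOp)
    (hU : U ∈ Matrix.unitaryGroup (Fin 2 × Fin 2) ℂ) :
    ∃ l : Fin 4 → ℂ, (∀ k, star (l k) * l k = 1) ∧ LocallyEquivalent U (magicDiag l) := by
  have hU' : Uᴴ * U = 1 := Matrix.mem_unitaryGroup_iff'.mp hU
  set M : Matrix (Fin 4) (Fin 4) ℂ := (1 / 2 : ℂ) • (magicᴴ * U * magic) with hM
  have hMM : Mᴴ * M = 1 := by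
    have : Mᴴ * M = ((1 / 2 : ℂ) * (1 / 2)) •
        (magicᴴ * Uᴴ * (magic * magicᴴ) * U * magic) := by
      rw [hM]
      simp [conjTranspose_mul, Matrix.mul_assoc, smul_smul]
    rw [this, magic_mul_conjTranspose]
    simp only [Matrix.mul_smul, Matrix.smul_mul, Matrix.mul_one]
    rw [Matrix.mul_assoc magicᴴ, hU', Matrix.mul_one, conjTranspose_mul_magic]
    simp only [smul_smul]
    norm_num
  have hMU : magic * M * magicᴴ = (2 : ℂ) • U := by
    have : magic * M * magicᴴ = (1 / 2 : ℂ) • ((magic * magicᴴ) * U * (magic * magicᴴ)) := by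
      rw [hM]
      simp [Matrix.mul_assoc]
    rw [this, magic_mul_conjTranspose]
    simp only [Matrix.mul_smul, Matrix.smul_mul, Matrix.mul_one, Matrix.one_mul, smul_smul]
    norm_num
  set m := Mᵀ * M with hm
  have hms : mᵀ = m := by rw [hm, transpose_mul, transpose_transpose]
  have hMM' : M * Mᴴ = 1 := mul_eq_one_comm.mp hMM
  have hMT : Mᵀ * (Mᵀ)ᴴ = 1 := by
    have := congrArg Matrix.transpose hMM
    rw [transpose_mul, transpose_one] at this
    exact this
  have hmu : m * mᴴ = 1 := by
    rw [hm, conjTranspose_mul, mul_assoc, ← mul_assoc M, hMM', one_mul, hMT]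
  have hsym : ∀ i j, m i j = m j i := fun i j => congrFun (congrFun hms j) i
  obtain ⟨O, a, b, hO, ha, hb⟩ := exists_orthogonal_diagonalizing (m.map Complex.re)
    (m.map Complex.im) (by ext i j; simp [hsym j i]) (by ext i j; simp [hsym j i])
    (commute_re_im_of_symmetric_unitary hms hmu)
  set C : Matrix (Fin 4) (Fin 4) ℂ := O.map Complex.ofReal with hC
  have hCH : Cᴴ = Cᵀ := by ext i j; simp [hC]
  have hCC : Cᵀ * C = 1 := by
    have := congrArg (fun X : Matrix (Fin 4) (Fin 4) ℝ => X.map Complex.ofRealHom) hO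
    simp only [Matrix.map_mul, Matrix.map_one _ (map_zero _) (map_one _)] at this
    exact this
  have hCC' : C * Cᵀ = 1 := mul_eq_one_comm.mp hCC
  set μ : Fin 4 → ℂ := fun k => a k + b k * Complex.I with hμ
  have hmC : m * C = C * diagonal μ := by
    ext i j
    have h1 := congrFun (congrFun ha i) j
    have h2 := congrFun (congrFun hb i) j
    rw [mul_diagonal] at h1 h2 ⊢
    simp only [Matrix.mul_apply, Matrix.map_apply] at h1 h2 ⊢
    apply Complex.ext
    · simp [hC, hμ, h1]
    · simp [hC, hμ, h2]
  have hD : Cᵀ * m * C = diagonal μ := by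
    rw [mul_assoc, hmC, ← mul_assoc, hCC, one_mul]
  have hmu' : mᴴ * m = 1 := mul_eq_one_comm.mp hmu
  have hμ1 : ∀ k, star (μ k) * μ k = 1 := fun k => by
    have h : (diagonal μ)ᴴ * diagonal μ = 1 := by
      rw [← hD]
      simp only [conjTranspose_mul, ← hCH, conjTranspose_conjTranspose]
      rw [hCH]
      calc Cᵀ * (mᴴ * C) * (Cᵀ * m * C) = Cᵀ * (mᴴ * (C * Cᵀ) * m) * C := by
            simp only [mul_assoc]
        _ = 1 := by rw [hCC', mul_one, hmu', mul_one, hCC]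
    rw [diagonal_conjTranspose, diagonal_mul_diagonal] at h
    simpa using congrFun (congrFun h k) k
  choose f hf using fun k => IsAlgClosed.exists_pow_nat_eq (μ k) (n := 2) (by norm_num)
  have hf1 : ∀ k, star (f k) * f k = 1 := fun k => by
    have h := hμ1 k
    rw [← hf k] at h
    have h2 : ‖f k‖ = 1 := by
      have := congrArg norm h
      simp only [norm_mul, norm_star, norm_pow, norm_one] at this
      rw [← pow_add] at this
      exact (pow_eq_one_iff_of_nonneg (norm_nonneg _) (by norm_num)).mp this
    have := Complex.conj_mul' (f k)
    rw [h2] at this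
    simpa using this
  set P := M * C * diagonal (star f) with hP
  have hPT : Pᵀ * P = 1 := by
    have : Pᵀ * P = diagonal (star f) * (Cᵀ * m * C) * diagonal (star f) := by
      simp only [hP, hm, transpose_mul, diagonal_transpose, mul_assoc]
    rw [this, hD, diagonal_mul_diagonal, diagonal_mul_diagonal, ← diagonal_one]
    congr 1
    ext k
    have h1 := hf1 k
    simp only [Pi.star_apply, ← hf k]
    linear_combination (star (f k) * f k + 1) * h1
  have hPH : Pᴴ * P = 1 := by
    have : Pᴴ * P = (diagonal (star f))ᴴ * (Cᵀ * (Mᴴ * M) * C) * diagonal (star f) := by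
      simp only [hP, conjTranspose_mul, hCH, mul_assoc]
    rw [this, hMM, mul_one, hCC, mul_one, diagonal_conjTranspose, diagonal_mul_diagonal,
      ← diagonal_one]
    congr 1
    ext k
    have h1 := hf1 k
    simp only [Pi.star_apply, star_star]
    linear_combination h1
  have hreal : Pᵀ = Pᴴ := by
    have h := mul_eq_one_comm.mp hPH
    calc Pᵀ = Pᵀ * (P * Pᴴ) := by rw [h, mul_one]
      _ = Pᴴ := by rw [← mul_assoc, hPT, one_mul]
  have hPre : P = (P.map Complex.re).map Complex.ofReal := by
    ext i j
    have h := congrFun (congrFun hreal j) i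
    simp only [transpose_apply, conjTranspose_apply] at h
    exact (Complex.conj_eq_iff_re.mp h.symm).symm
  have hPO : (P.map Complex.re)ᵀ * P.map Complex.re = 1 := by
    ext i j
    have h := congrFun (congrFun hPT i) j
    apply Complex.ofReal_injective
    rw [Matrix.mul_apply] at h ⊢
    have hPij : ∀ i j, ((P i j).re : ℂ) = P i j := fun i j => (congrFun (congrFun hPre i) j).symm
    simp only [transpose_apply, Matrix.map_apply] at h ⊢
    push_cast
    simp only [hPij]
    rw [h, Matrix.one_apply, Matrix.one_apply]
    split_ifs <;> simp
  have hMP : M = P * diagonal f * Cᴴ := by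
    have h : diagonal (star f) * diagonal f = 1 := by
      rw [diagonal_mul_diagonal, ← diagonal_one]
      congr 1
      ext k
      exact hf1 k
    rw [hP, mul_assoc _ _ (diagonal f), h, mul_one, hCH, mul_assoc, hCC', mul_one]
  obtain ⟨V, hV, W, hW, d, hd, hd', h⟩ := magic_mul_orthogonal _ hPO
  obtain ⟨V', hV', W', hW', e, he, he', h'⟩ := magic_mul_orthogonal _ hO
  rw [← hPre] at h
  rw [← hC] at h'
  refine ⟨fun k => d k * f k * e k, fun k => ?_, V, hV, W, hW, star V', Unitary.star_mem hV',
    star W', Unitary.star_mem hW', ?_⟩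
  · have h1 := hf1 k
    simp only [star_mul', hd', he']
    linear_combination (d k * d k * e k * e k) * h1 + e k * e k * hd k + he k
  · have h1 : U = (1 / 2 : ℂ) • (magic * M * magicᴴ) := by
      rw [hMU, smul_smul]; norm_num
    have h2 : diagonal (fun k => d k * f k * e k) = diagonal d * diagonal f * (diagonal e)ᴴ := by
      rw [diagonal_conjTranspose, diagonal_mul_diagonal, diagonal_mul_diagonal]
      congr 1
      ext k
      simp only [Pi.star_apply, he']
    have h3 : star V' ⊗ₖ star W' = (V' ⊗ₖ W')ᴴ := (conjTranspose_kronecker _ _).symm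
    have h4 : magic * M * magicᴴ = (magic * P) * diagonal f * (magic * C)ᴴ := by
      rw [hMP, conjTranspose_mul]
      simp only [Matrix.mul_assoc]
    rw [h1, h4, h, h', magicDiag, h2, h3]
    simp only [conjTranspose_mul, Matrix.mul_assoc, Matrix.mul_smul, Matrix.smul_mul]

section

open Matrix

theorem magic_apply (p : Fin 2 × Fin 2) (k : Fin 4) :
    magic p k = (![!![1, 0; 0, 1], !![Complex.I, 0; 0, -Complex.I], !![0, 1; -1, 0],
      !![0, Complex.I; Complex.I, 0]] : Fin 4 → Matrix (Fin 2) (Fin 2) ℂ) k p.1 p.2 := by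
  obtain ⟨a, b⟩ := p
  fin_cases k <;> fin_cases a <;> fin_cases b <;>
    simp [magic, quatMatrix, quatUnit, Complex.ext_iff]

theorem magicDiag_apply (l : Fin 4 → ℂ) (p q : Fin 2 × Fin 2) :
    magicDiag l p q = 1 / 2 * ∑ k, magic p k * l k * star (magic q k) := by
  rw [magicDiag, Matrix.smul_apply, Matrix.mul_apply, smul_eq_mul]
  simp only [Matrix.mul_diagonal, conjTranspose_apply]

theorem locallyEquivalent_magicDiag_comp (l : Fin 4 → ℂ) (π : Equiv.Perm (Fin 4)) :
    LocallyEquivalent (magicDiag (l ∘ π)) (magicDiag l) := by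
  set O : Matrix (Fin 4) (Fin 4) ℝ := of fun i k => if π i = k then 1 else 0 with hO
  set C : Matrix (Fin 4) (Fin 4) ℂ := O.map Complex.ofReal with hC
  have hOO : Oᵀ * O = 1 := by
    ext i j
    rw [Matrix.mul_apply, Matrix.one_apply, ← Equiv.sum_comp π.symm]
    simp [hO, eq_comm]
  have hD : diagonal (l ∘ π) = C * diagonal l * Cᴴ := by
    ext i j
    rw [Matrix.mul_apply]
    have hCe : ∀ i k, C i k = if π i = k then 1 else 0 := fun i k => by
      simp [hC, hO, apply_ite Complex.ofReal]
    simp only [hCe, Matrix.mul_diagonal, conjTranspose_apply]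
    by_cases h : i = j
    · simp [h]
    · simp [h]
  obtain ⟨V, hV, W, hW, d, hd, hd', h⟩ := magic_mul_orthogonal O hOO
  refine ⟨V, hV, W, hW, star V, Unitary.star_mem hV, star W, Unitary.star_mem hW, ?_⟩
  have h3 : star V ⊗ₖ star W = (V ⊗ₖ W)ᴴ := (conjTranspose_kronecker _ _).symm
  have h4 : magic * (C * diagonal l * Cᴴ) * magicᴴ = (magic * C) * diagonal l * (magic * C)ᴴ := by
    rw [conjTranspose_mul]
    simp only [Matrix.mul_assoc]
  have h5 : diagonal d * (diagonal l * (diagonal d)ᴴ) = diagonal l := by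
    rw [diagonal_conjTranspose, diagonal_mul_diagonal, diagonal_mul_diagonal]
    congr 1
    ext k
    simp only [Pi.star_apply, hd']
    linear_combination l k * hd k
  rw [magicDiag, hD, h4, h, h3, magicDiag]
  conv_rhs => rw [← h5]
  simp only [conjTranspose_mul, Matrix.mul_assoc, Matrix.mul_smul, Matrix.smul_mul]

theorem smul_mem_unitaryGroup {z : ℂ} (hz : star z * z = 1) {V : Matrix (Fin 2) (Fin 2) ℂ}
    (hV : V ∈ unitaryGroup (Fin 2) ℂ) : z • V ∈ unitaryGroup (Fin 2) ℂ := by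
  rw [mem_unitaryGroup_iff'] at *
  rw [star_smul, Matrix.smul_mul, Matrix.mul_smul, hV, smul_smul, hz, one_smul]

theorem locallyEquivalent_magicDiag_smul (l : Fin 4 → ℂ) {z : ℂ} (hz : star z * z = 1) :
    LocallyEquivalent (magicDiag (z • l)) (magicDiag l) := by
  refine ⟨z • 1, smul_mem_unitaryGroup hz (one_mem _), 1, one_mem _, 1, one_mem _, 1, one_mem _, ?_⟩
  rw [smul_kronecker, one_kronecker_one, mul_one, Matrix.smul_mul, one_mul, magicDiag, magicDiag,
    diagonal_smul]
  simp only [Matrix.mul_smul, Matrix.smul_mul]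
  rw [smul_comm]

theorem locallyEquivalent_magicDiag_neg (l : Fin 4 → ℂ) :
    LocallyEquivalent (magicDiag ![-l 0, -l 1, l 2, l 3]) (magicDiag l) := by
  have hZ : !![1, 0; 0, (-1 : ℂ)] ∈ unitaryGroup (Fin 2) ℂ := by
    rw [mem_unitaryGroup_iff]
    ext i j
    fin_cases i <;> fin_cases j <;> simp [Matrix.mul_apply]
  refine ⟨(-1 : ℂ) • !![1, 0; 0, (-1 : ℂ)], smul_mem_unitaryGroup (by simp) hZ, _, hZ, 1, one_mem _,
    1, one_mem _, ?_⟩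
  have h : (((-1 : ℂ) • !![1, 0; 0, (-1 : ℂ)]) ⊗ₖ !![1, 0; 0, (-1 : ℂ)]) * magic
      = magic * diagonal (![-1, -1, 1, 1] : Fin 4 → ℂ) := by
    ext ⟨i, i'⟩ j
    rw [Matrix.mul_diagonal, Matrix.mul_apply, Fintype.sum_prod_type]
    simp only [Fin.sum_univ_two, magic_apply]
    fin_cases i <;> fin_cases i' <;> fin_cases j <;>
      simp
  have h2 : diagonal ![-l 0, -l 1, l 2, l 3] = diagonal (![-1, -1, 1, 1] : Fin 4 → ℂ) * diagonal l := by
    rw [diagonal_mul_diagonal]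
    congr 1
    ext k
    fin_cases k <;> simp
  rw [one_kronecker_one, mul_one, magicDiag, magicDiag, h2, Matrix.mul_smul, ← Matrix.mul_assoc,
    ← Matrix.mul_assoc, ← Matrix.mul_assoc, h]

theorem magicDiag_map_conj (l : Fin 4 → ℂ) :
    (magicDiag l).map (starRingEnd ℂ) = magicDiag (star l) := by
  ext ⟨i, i'⟩ ⟨j, j'⟩
  rw [Matrix.map_apply, magicDiag_apply, magicDiag_apply]
  simp only [Fin.sum_univ_four, magic_apply]
  fin_cases i <;> fin_cases i' <;> fin_cases j <;> fin_cases j' <;>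
    simp [Complex.conj_ofNat]

/-- The matrix of coefficients of the Choi state. -/
noncomputable def choiMatrix (U : TwoQubitOp) : Matrix (Fin 2 × Fin 2) (Fin 2 × Fin 2) ℂ :=
  of fun p q => choiState U (p, q)

theorem choiMatrix_apply (U : TwoQubitOp) (p q : Fin 2 × Fin 2) :
    choiMatrix U p q = 1 / 2 * U (p.1, q.1) (p.2, q.2) := by
  have h : (Real.sqrt 2 : ℂ)⁻¹ * (Real.sqrt 2 : ℂ)⁻¹ = 1 / 2 := by
    rw [← mul_inv, ← Complex.ofReal_mul, Real.mul_self_sqrt (by norm_num)]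
    norm_num
  obtain ⟨a, a'⟩ := p
  obtain ⟨b, b'⟩ := q
  fin_cases a' <;> fin_cases b' <;>
    simp [choiMatrix, choiState, maxEntangled, h, mul_comm]

theorem choiMatrix_local (U : TwoQubitOp) (V W V' W' : Matrix (Fin 2) (Fin 2) ℂ) :
    choiMatrix ((V ⊗ₖ W) * U * (V' ⊗ₖ W')) = (V ⊗ₖ V'ᵀ) * choiMatrix U * (W ⊗ₖ W'ᵀ)ᵀ := by
  ext ⟨a, a'⟩ ⟨b, b'⟩
  rw [choiMatrix_apply]
  simp only [Matrix.mul_apply, Fintype.sum_prod_type, Fin.sum_univ_two, kroneckerMap_apply,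
    transpose_apply, choiMatrix_apply]
  ring

/-- A decomposition of the Choi state along orthonormal families, with complex coefficients. -/
def HasComplexSchmidtCoeffs (U : TwoQubitOp) (x : Fin 4 → ℂ) : Prop :=
  ∃ E F : Matrix (Fin 2 × Fin 2) (Fin 4) ℂ, Eᴴ * E = 1 ∧ Fᴴ * F = 1 ∧
    choiMatrix U = E * diagonal x * Fᵀ

theorem HasSchmidtCoeffs.complex {U : TwoQubitOp} {s : Fin 4 → ℝ} (h : HasSchmidtCoeffs U s) :
    HasComplexSchmidtCoeffs U (fun j => (s j : ℂ)) := by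
  obtain ⟨-, -, e, f, he, hf, h⟩ := h
  have key : ∀ e : Fin 4 → EuclideanSpace ℂ (Fin 2 × Fin 2), Orthonormal ℂ e →
      (of fun p j => e j p : Matrix (Fin 2 × Fin 2) (Fin 4) ℂ)ᴴ * (of fun p j => e j p) = 1 := by
    intro e he
    ext i j
    rw [Matrix.one_apply, ← orthonormal_iff_ite.mp he i j, EuclideanSpace.inner_eq_star_dotProduct]
    simp only [Matrix.mul_apply, dotProduct, conjTranspose_apply, of_apply, Pi.star_apply]
    exact Finset.sum_congr rfl fun _ _ => mul_comm _ _
  refine ⟨_, _, key e he, key f hf, ?_⟩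
  ext p q
  rw [choiMatrix, of_apply, h, Matrix.mul_apply]
  refine Finset.sum_congr rfl fun j _ => ?_
  rw [Matrix.mul_diagonal, transpose_apply, of_apply, of_apply]
  ring

theorem HasComplexSchmidtCoeffs.of_locallyEquivalent {U U' : TwoQubitOp} {x : Fin 4 → ℂ}
    (h : HasComplexSchmidtCoeffs U x) (h' : LocallyEquivalent U' U) :
    HasComplexSchmidtCoeffs U' x := by
  obtain ⟨E, F, hE, hF, h⟩ := h
  obtain ⟨V, hV, W, hW, V', hV', W', hW', rfl⟩ := h'
  have key : ∀ V V' : Matrix (Fin 2) (Fin 2) ℂ, V ∈ unitaryGroup (Fin 2) ℂ →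
      V' ∈ unitaryGroup (Fin 2) ℂ → ∀ E : Matrix (Fin 2 × Fin 2) (Fin 4) ℂ, Eᴴ * E = 1 →
      ((V ⊗ₖ V'ᵀ) * E)ᴴ * ((V ⊗ₖ V'ᵀ) * E) = 1 := by
    intro V V' hV hV' E hE
    rw [conjTranspose_mul, Matrix.mul_assoc, ← Matrix.mul_assoc _ _ E, conjTranspose_kronecker,
      ← star_eq_conjTranspose, ← star_eq_conjTranspose,
      star_kronecker_mul_self hV (transpose_mem_unitaryGroup hV'), Matrix.one_mul, hE]
  refine ⟨_, _, key V V' hV hV' E hE, key W W' hW hW' F hF, ?_⟩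
  rw [choiMatrix_local, h, transpose_mul]
  simp only [Matrix.mul_assoc]

/-- The coefficients of `magicDiag l` in the basis of the tensor squares of the Pauli matrices, up
to signs. -/
noncomputable def pauliCoeff (l : Fin 4 → ℂ) : Fin 4 → ℂ :=
  ![(l 0 + l 1 + l 2 + l 3) / 4, (l 0 + l 1 - l 2 - l 3) / 4,
    (l 0 - l 1 + l 2 - l 3) / 4, (l 0 - l 1 - l 2 + l 3) / 4]

theorem hasComplexSchmidtCoeffs_magicDiag (l : Fin 4 → ℂ) :
    HasComplexSchmidtCoeffs (magicDiag l) (fun k => ![1, -1, 1, -1] k * pauliCoeff l k) := by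
  have h2 : (Real.sqrt 2 : ℂ)⁻¹ * (Real.sqrt 2 : ℂ)⁻¹ = 1 / 2 := by
    rw [← mul_inv, ← Complex.ofReal_mul, Real.mul_self_sqrt (by norm_num)]
    norm_num
  have hE : ((Real.sqrt 2 : ℂ)⁻¹ • magic)ᴴ * ((Real.sqrt 2 : ℂ)⁻¹ • magic) = 1 := by
    rw [conjTranspose_smul, Matrix.smul_mul, Matrix.mul_smul, conjTranspose_mul_magic, smul_smul,
      smul_smul]
    have : star (Real.sqrt 2 : ℂ)⁻¹ = (Real.sqrt 2 : ℂ)⁻¹ := by simp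
    rw [this, h2]
    norm_num
  refine ⟨_, _, hE, hE, ?_⟩
  rw [transpose_smul, Matrix.smul_mul, Matrix.smul_mul, Matrix.mul_smul, smul_smul, h2]
  ext ⟨a, a'⟩ ⟨b, b'⟩
  rw [choiMatrix_apply, magicDiag_apply, Matrix.smul_apply, Matrix.mul_apply]
  simp only [Matrix.mul_diagonal, Fin.sum_univ_four, transpose_apply, magic_apply]
  fin_cases a <;> fin_cases a' <;> fin_cases b <;> fin_cases b' <;>
    simp [pauliCoeff] <;> ring_nf <;> simp <;> ring_nf

theorem HasComplexSchmidtCoeffs.charpoly {U : TwoQubitOp} {x : Fin 4 → ℂ}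
    (h : HasComplexSchmidtCoeffs U x) :
    (choiMatrix U * (choiMatrix U)ᴴ).charpoly
      = ∏ i, (Polynomial.X - Polynomial.C ((Complex.normSq (x i) : ℝ) : ℂ)) := by
  obtain ⟨E, F, hE, hF, h⟩ := h
  have hF' : Fᵀ * Fᵀᴴ = 1 := by
    have := congrArg Matrix.transpose hF
    rw [transpose_mul, transpose_one] at this
    exact this
  have h1 : choiMatrix U * (choiMatrix U)ᴴ
      = E * (diagonal (fun i => ((Complex.normSq (x i) : ℝ) : ℂ)) * Eᴴ) := by
    have : diagonal (fun i => ((Complex.normSq (x i) : ℝ) : ℂ)) = diagonal x * (diagonal x)ᴴ := by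
      rw [diagonal_conjTranspose, diagonal_mul_diagonal]
      congr 1
      ext k
      exact (Complex.mul_conj (x k)).symm
    rw [this, h, conjTranspose_mul, conjTranspose_mul, Matrix.mul_assoc (E * diagonal x),
      ← Matrix.mul_assoc Fᵀ, hF', Matrix.one_mul]
    simp only [Matrix.mul_assoc]
  rw [h1, charpoly_mul_comm_of_le _ _ (by simp), Matrix.mul_assoc, hE, Matrix.mul_one,
    charpoly_diagonal]
  simp

theorem HasComplexSchmidtCoeffs.exists_perm {U : TwoQubitOp} {x y : Fin 4 → ℂ}
    (hx : HasComplexSchmidtCoeffs U x) (hy : HasComplexSchmidtCoeffs U y) :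
    ∃ σ : Equiv.Perm (Fin 4), ∀ i, Complex.normSq (x i) = Complex.normSq (y (σ i)) := by
  classical
  have h := hx.charpoly.symm.trans hy.charpoly
  have key : ∀ z : Fin 4 → ℂ, (∏ i, (Polynomial.X - Polynomial.C ((Complex.normSq (z i) : ℝ) : ℂ))).roots
      = Finset.univ.val.map fun i => ((Complex.normSq (z i) : ℝ) : ℂ) := fun z => by
    rw [← Polynomial.roots_multiset_prod_X_sub_C (Finset.univ.val.map _), Multiset.map_map]
    rfl
  have h2 := congrArg Polynomial.roots h
  rw [key, key] at h2
  obtain ⟨σ, hσ⟩ := exists_perm_of_map_univ_eq _ _ h2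
  exact ⟨σ, fun i => Complex.ofReal_injective (hσ i)⟩

end

section

open Matrix

theorem star_smul_mul_smul_self {l : Fin 4 → ℂ} (hl : ∀ k, star (l k) * l k = 1)
    {z : ℂ} (hz : star z * z = 1) (k : Fin 4) : star ((z • l) k) * (z • l) k = 1 := by
  simp only [Pi.smul_apply, smul_eq_mul, star_mul']
  linear_combination star (l k) * l k * hz + hl k

theorem exists_locallyEquivalent_pauliCoeff_perm (σ : Equiv.Perm (Fin 4)) (l : Fin 4 → ℂ)
    (hl : ∀ k, star (l k) * l k = 1) :
    ∃ m : Fin 4 → ℂ, (∀ k, star (m k) * m k = 1) ∧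
      LocallyEquivalent (magicDiag m) (magicDiag l) ∧
      ∀ j, Complex.normSq (pauliCoeff m j) = Complex.normSq (pauliCoeff l (σ j)) := by
  have hσ : σ ∈ Submonoid.closure (Set.range fun i : Fin 3 => Equiv.swap i.castSucc i.succ) := by
    rw [Equiv.Perm.mclosure_swap_castSucc_succ]
    trivial
  induction hσ using Submonoid.closure_induction generalizing l with
  | mem σ hσ =>
    obtain ⟨i, rfl⟩ := hσ
    fin_cases i
    · refine ⟨![-l 0, -l 1, l 3, l 2], ?_, ?_, ?_⟩
      · intro k
        fin_cases k
        · simpa using hl 0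
        · simpa using hl 1
        · exact hl 3
        · exact hl 2
      · refine LocallyEquivalent.trans ?_ (locallyEquivalent_magicDiag_neg l)
        have h := locallyEquivalent_magicDiag_comp ![-l 0, -l 1, l 2, l 3] (Equiv.swap 2 3)
        have h' : ![-l 0, -l 1, l 2, l 3] ∘ (Equiv.swap 2 3) = ![-l 0, -l 1, l 3, l 2] := by
          ext k
          fin_cases k <;> rfl
        rwa [h'] at h
      · intro j
        rw [← Complex.normSq_neg]
        congr 1
        fin_cases j
        · change -((-l 0 + -l 1 + l 3 + l 2) / 4) = (l 0 + l 1 - l 2 - l 3) / 4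
          ring
        · change -((-l 0 + -l 1 - l 3 - l 2) / 4) = (l 0 + l 1 + l 2 + l 3) / 4
          ring
        · change -((-l 0 - -l 1 + l 3 - l 2) / 4) = (l 0 - l 1 + l 2 - l 3) / 4
          ring
        · change -((-l 0 - -l 1 - l 3 + l 2) / 4) = (l 0 - l 1 - l 2 + l 3) / 4
          ring
    · refine ⟨l ∘ Equiv.swap 1 2, fun k => hl _, locallyEquivalent_magicDiag_comp _ _, fun j => ?_⟩
      congr 1
      fin_cases j
      · change (l 0 + l 2 + l 1 + l 3) / 4 = (l 0 + l 1 + l 2 + l 3) / 4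
        ring
      · change (l 0 + l 2 - l 1 - l 3) / 4 = (l 0 - l 1 + l 2 - l 3) / 4
        ring
      · change (l 0 - l 2 + l 1 - l 3) / 4 = (l 0 + l 1 - l 2 - l 3) / 4
        ring
      · change (l 0 - l 2 - l 1 + l 3) / 4 = (l 0 - l 1 - l 2 + l 3) / 4
        ring
    · refine ⟨l ∘ Equiv.swap 2 3, fun k => hl _, locallyEquivalent_magicDiag_comp _ _, fun j => ?_⟩
      congr 1
      fin_cases j
      · change (l 0 + l 1 + l 3 + l 2) / 4 = (l 0 + l 1 + l 2 + l 3) / 4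
        ring
      · change (l 0 + l 1 - l 3 - l 2) / 4 = (l 0 + l 1 - l 2 - l 3) / 4
        ring
      · change (l 0 - l 1 + l 3 - l 2) / 4 = (l 0 - l 1 - l 2 + l 3) / 4
        ring
      · change (l 0 - l 1 - l 3 + l 2) / 4 = (l 0 - l 1 + l 2 - l 3) / 4
        ring
  | one =>
    exact ⟨l, hl, locallyEquivalent_magicDiag_comp l 1, fun j => rfl⟩
  | mul σ τ _ _ hσ hτ =>
    obtain ⟨m, hm, hml, h⟩ := hσ l hl
    obtain ⟨m', hm', hml', h'⟩ := hτ m hm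
    exact ⟨m', hm', hml'.trans hml, fun j => (h' j).trans (h _)⟩

theorem locallyEquivalent_magicDiag_of_mul_eq {l x : Fin 4 → ℂ} (π : Equiv.Perm (Fin 4))
    (hl : l 0 * l 1 * l 2 * l 3 = 1) (hx : x (π 0) * x (π 1) * x (π 2) * x (π 3) = 1)
    (h1 : l 0 * l 1 = x (π 0) * x (π 1)) (h2 : l 0 * l 2 = x (π 0) * x (π 2))
    (h3 : l 0 * l 3 = x (π 0) * x (π 3)) : LocallyEquivalent (magicDiag l) (magicDiag x) := by
  refine LocallyEquivalent.trans ?_ (locallyEquivalent_magicDiag_comp x π)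
  have h0 : l 0 ≠ 0 := by
    intro h
    simp [h] at hl
  have hsq : l 0 ^ 2 = x (π 0) ^ 2 := by
    have e1 : l 0 ^ 2 = (l 0 * l 1) * (l 0 * l 2) * (l 0 * l 3) := by
      linear_combination -l 0 ^ 2 * hl
    rw [e1, h1, h2, h3]
    linear_combination x (π 0) ^ 2 * hx
  obtain ⟨z, hz, hz0⟩ : ∃ z : ℂ, (z = 1 ∨ z = -1) ∧ l 0 = z * x (π 0) := by
    rcases sq_eq_sq_iff_eq_or_eq_neg.mp hsq with h | h
    · exact ⟨1, Or.inl rfl, by rw [h, one_mul]⟩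
    · exact ⟨-1, Or.inr rfl, by rw [h, neg_one_mul]⟩
  have hzz : z * z = 1 := by rcases hz with rfl | rfl <;> norm_num
  have hz' : star z * z = 1 := by rcases hz with rfl | rfl <;> simp
  have hxz : x (π 0) = z * l 0 := by
    rw [hz0]
    linear_combination -x (π 0) * hzz
  have hlx : l = z • (x ∘ π) := by
    ext k
    apply mul_left_cancel₀ h0
    fin_cases k
    · change l 0 * l 0 = l 0 * (z * x (π 0))
      rw [← hz0]
    · change l 0 * l 1 = l 0 * (z * x (π 1))
      rw [h1, hxz]
      ring
    · change l 0 * l 2 = l 0 * (z * x (π 2))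
      rw [h2, hxz]
      ring
    · change l 0 * l 3 = l 0 * (z * x (π 3))
      rw [h3, hxz]
      ring
  rw [hlx]
  exact locallyEquivalent_magicDiag_smul _ hz'

theorem eq_or_eq_star_of_re_eq {z w : ℂ} (hz : star z * z = 1) (hw : star w * w = 1)
    (h : z.re = w.re) : z = w ∨ z = star w := by
  have h1 := congrArg Complex.re hz
  have h2 := congrArg Complex.re hw
  simp only [Complex.star_def, Complex.mul_re, Complex.conj_re, Complex.conj_im,
    Complex.one_re] at h1 h2
  have h3 : z.im ^ 2 = w.im ^ 2 := by
    rw [h] at h1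
    linear_combination h1 - h2
  rcases sq_eq_sq_iff_eq_or_eq_neg.mp h3 with h4 | h4
  · exact Or.inl (Complex.ext h h4)
  · exact Or.inr (Complex.ext h h4)

theorem locallyEquivalent_magicDiag_of_re_eq {l m : Fin 4 → ℂ} (hl : ∀ k, star (l k) * l k = 1)
    (hm : ∀ k, star (m k) * m k = 1) (hl' : l 0 * l 1 * l 2 * l 3 = 1)
    (hm' : m 0 * m 1 * m 2 * m 3 = 1) (h1 : (m 0 * m 1).re = (l 0 * l 1).re)
    (h2 : (m 0 * m 2).re = (l 0 * l 2).re) (h3 : (m 0 * m 3).re = (l 0 * l 3).re) :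
    LocallyEquivalent (magicDiag m) (magicDiag l) ∨
      LocallyEquivalent (magicDiag m) (magicDiag (star l)) := by
  have hmul : ∀ z w : ℂ, star z * z = 1 → star w * w = 1 → star (z * w) * (z * w) = 1 := by
    intro z w hz hw
    rw [star_mul']
    linear_combination star w * w * hz + hw
  have key : ∀ a b c d : ℂ, star a * a = 1 → star b * b = 1 → a * b * c * d = 1 →
      star a * star b = c * d := by
    intro a b c d ha hb h
    linear_combination -star a * star b * h + c * d * (star b * b * ha + hb)
  have hl'' : star (l 0) * star (l 1) * star (l 2) * star (l 3) = 1 := by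
    have := congrArg star hl'
    simpa only [star_mul', star_one] using this
  have k01 := key _ _ _ _ (hl 0) (hl 1) hl'
  have k02 := key _ _ (l 1) (l 3) (hl 0) (hl 2) (by linear_combination hl')
  have k03 := key _ _ (l 1) (l 2) (hl 0) (hl 3) (by linear_combination hl')
  have k12 := key _ _ (l 0) (l 3) (hl 1) (hl 2) (by linear_combination hl')
  have k13 := key _ _ (l 0) (l 2) (hl 1) (hl 3) (by linear_combination hl')
  have k23 := key _ _ (l 0) (l 1) (hl 2) (hl 3) (by linear_combination hl')
  rcases eq_or_eq_star_of_re_eq (hmul _ _ (hm 0) (hm 1)) (hmul _ _ (hl 0) (hl 1)) h1 with h1 | h1 <;>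
  rcases eq_or_eq_star_of_re_eq (hmul _ _ (hm 0) (hm 2)) (hmul _ _ (hl 0) (hl 2)) h2 with h2 | h2 <;>
  rcases eq_or_eq_star_of_re_eq (hmul _ _ (hm 0) (hm 3)) (hmul _ _ (hl 0) (hl 3)) h3 with h3 | h3 <;>
  try simp only [star_mul'] at h1 h2 h3
  · exact Or.inl (locallyEquivalent_magicDiag_of_mul_eq 1 hm' hl' h1 h2 h3)
  · refine Or.inr (locallyEquivalent_magicDiag_of_mul_eq (Equiv.swap 0 3 * Equiv.swap 1 2) hm' ?_ ?_ ?_ ?_)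
    · change star (l 3) * star (l 2) * star (l 1) * star (l 0) = 1
      linear_combination hl''
    · change _ = star (l 3) * star (l 2)
      linear_combination h1 - k23
    · change _ = star (l 3) * star (l 1)
      linear_combination h2 - k13
    · change _ = star (l 3) * star (l 0)
      linear_combination h3
  · refine Or.inr (locallyEquivalent_magicDiag_of_mul_eq (Equiv.swap 0 2 * Equiv.swap 1 3) hm' ?_ ?_ ?_ ?_)
    · change star (l 2) * star (l 3) * star (l 0) * star (l 1) = 1
      linear_combination hl''
    · change _ = star (l 2) * star (l 3)
      linear_combination h1 - k23
    · change _ = star (l 2) * star (l 0)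
      linear_combination h2
    · change _ = star (l 2) * star (l 1)
      linear_combination h3 - k12
  · refine Or.inl (locallyEquivalent_magicDiag_of_mul_eq (Equiv.swap 0 1 * Equiv.swap 2 3) hm' ?_ ?_ ?_ ?_)
    · change l 1 * l 0 * l 3 * l 2 = 1
      linear_combination hl'
    · change _ = l 1 * l 0
      linear_combination h1
    · change _ = l 1 * l 3
      linear_combination h2 + k02
    · change _ = l 1 * l 2
      linear_combination h3 + k03
  · refine Or.inr (locallyEquivalent_magicDiag_of_mul_eq (Equiv.swap 0 1 * Equiv.swap 2 3) hm' ?_ ?_ ?_ ?_)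
    · change star (l 1) * star (l 0) * star (l 3) * star (l 2) = 1
      linear_combination hl''
    · change _ = star (l 1) * star (l 0)
      linear_combination h1
    · change _ = star (l 1) * star (l 3)
      linear_combination h2 - k13
    · change _ = star (l 1) * star (l 2)
      linear_combination h3 - k12
  · refine Or.inl (locallyEquivalent_magicDiag_of_mul_eq (Equiv.swap 0 2 * Equiv.swap 1 3) hm' ?_ ?_ ?_ ?_)
    · change l 2 * l 3 * l 0 * l 1 = 1
      linear_combination hl'
    · change _ = l 2 * l 3
      linear_combination h1 + k01
    · change _ = l 2 * l 0
      linear_combination h2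
    · change _ = l 2 * l 1
      linear_combination h3 + k03
  · refine Or.inl (locallyEquivalent_magicDiag_of_mul_eq (Equiv.swap 0 3 * Equiv.swap 1 2) hm' ?_ ?_ ?_ ?_)
    · change l 3 * l 2 * l 1 * l 0 = 1
      linear_combination hl'
    · change _ = l 3 * l 2
      linear_combination h1 + k01
    · change _ = l 3 * l 1
      linear_combination h2 + k02
    · change _ = l 3 * l 0
      linear_combination h3
  · exact Or.inr (locallyEquivalent_magicDiag_of_mul_eq 1 hm' hl'' h1 h2 h3)

theorem re_mul_re_eq_normSq_pauliCoeff {l : Fin 4 → ℂ} (hl : ∀ k, star (l k) * l k = 1)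
    (hl' : l 0 * l 1 * l 2 * l 3 = 1) :
    (l 0 * l 2).re * (l 0 * l 3).re
        = Complex.normSq (pauliCoeff l 0) + Complex.normSq (pauliCoeff l 1)
          - Complex.normSq (pauliCoeff l 2) - Complex.normSq (pauliCoeff l 3) ∧
      (l 0 * l 1).re * (l 0 * l 3).re
        = Complex.normSq (pauliCoeff l 0) - Complex.normSq (pauliCoeff l 1)
          + Complex.normSq (pauliCoeff l 2) - Complex.normSq (pauliCoeff l 3) ∧
      (l 0 * l 1).re * (l 0 * l 2).re
        = Complex.normSq (pauliCoeff l 0) - Complex.normSq (pauliCoeff l 1)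
          - Complex.normSq (pauliCoeff l 2) + Complex.normSq (pauliCoeff l 3) := by
  have key : ∀ a b c d : ℂ, star a * a = 1 → star b * b = 1 → a * b * c * d = 1 →
      2 * ((a * c).re * (a * d).re) = (a * star b).re + (c * star d).re := by
    intro a b c d ha hb h
    have hb' : star b = a * c * d := by linear_combination -star b * h + a * c * d * hb
    have h1 := congrArg Complex.re ha
    simp only [Complex.star_def, Complex.mul_re, Complex.conj_re, Complex.conj_im,
      Complex.one_re] at h1
    rw [hb']
    simp only [Complex.star_def, Complex.mul_re, Complex.mul_im, Complex.conj_re, Complex.conj_im]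
    linear_combination (c.re * d.re + c.im * d.im) * h1
  have k1 := key _ _ _ _ (hl 0) (hl 1) hl'
  have k2 := key _ _ (l 1) (l 3) (hl 0) (hl 2) (by linear_combination hl')
  have k3 := key _ _ (l 1) (l 2) (hl 0) (hl 3) (by linear_combination hl')
  simp only [pauliCoeff, cons_val, Complex.normSq_div]
  have h4 : Complex.normSq 4 = 16 := by norm_num [Complex.normSq_apply]
  rw [h4]
  refine ⟨?_, ?_, ?_⟩
  · rw [← mul_right_inj' (two_ne_zero' ℝ), k1]
    simp only [Complex.normSq_apply, Complex.star_def, Complex.mul_re, Complex.conj_re,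
      Complex.conj_im, Complex.add_re, Complex.add_im, Complex.sub_re, Complex.sub_im]
    ring
  · rw [← mul_right_inj' (two_ne_zero' ℝ), k2]
    simp only [Complex.normSq_apply, Complex.star_def, Complex.mul_re, Complex.conj_re,
      Complex.conj_im, Complex.add_re, Complex.add_im, Complex.sub_re, Complex.sub_im]
    ring
  · rw [← mul_right_inj' (two_ne_zero' ℝ), k3]
    simp only [Complex.normSq_apply, Complex.star_def, Complex.mul_re, Complex.conj_re,
      Complex.conj_im, Complex.add_re, Complex.add_im, Complex.sub_re, Complex.sub_im]
    ring

/-- Three reals are determined up to a common sign by their pairwise products. -/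
theorem eq_or_eq_neg_of_mul_eq {u v w u' v' w' : ℝ} (hu : u ≠ 0) (hv : v ≠ 0) (hw : w ≠ 0)
    (h1 : v' * w' = v * w) (h2 : u' * w' = u * w) (h3 : u' * v' = u * v) :
    (u' = u ∧ v' = v ∧ w' = w) ∨ (u' = -u ∧ v' = -v ∧ w' = -w) := by
  have hsq : u' ^ 2 = u ^ 2 := by
    apply mul_right_cancel₀ (mul_ne_zero hv hw)
    linear_combination -u' ^ 2 * h1 + u' * v' * h2 + u * w * h3
  rcases sq_eq_sq_iff_eq_or_eq_neg.mp hsq with h | h <;> rw [h] at h2 h3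
  · exact Or.inl ⟨h, mul_left_cancel₀ hu h3, mul_left_cancel₀ hu h2⟩
  · exact Or.inr ⟨h, mul_left_cancel₀ hu (by linear_combination -h3),
      mul_left_cancel₀ hu (by linear_combination -h2)⟩

theorem exists_unimodular_smul_prod_eq_one {l : Fin 4 → ℂ} (hl : ∀ k, star (l k) * l k = 1) :
    ∃ z : ℂ, star z * z = 1 ∧ (z • l) 0 * (z • l) 1 * (z • l) 2 * (z • l) 3 = 1 := by
  have hn : ∀ k, ‖l k‖ = 1 := fun k => by
    have := congrArg norm (hl k)
    rw [norm_mul, norm_star, norm_one] at this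
    exact (pow_eq_one_iff_of_nonneg (norm_nonneg _) two_ne_zero).mp (by rw [pow_two, this])
  obtain ⟨z, hz⟩ := IsAlgClosed.exists_pow_nat_eq (star (l 0 * l 1 * l 2 * l 3)) (n := 4) (by norm_num)
  have hz1 : ‖z‖ = 1 := by
    have := congrArg norm hz
    rw [norm_pow, norm_star] at this
    simp only [norm_mul, hn, mul_one] at this
    exact (pow_eq_one_iff_of_nonneg (norm_nonneg _) four_ne_zero).mp this
  refine ⟨z, ?_, ?_⟩
  · have := Complex.conj_mul' z
    rw [hz1] at this
    simpa using this
  · simp only [Pi.smul_apply, smul_eq_mul]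
    have e : z * l 0 * (z * l 1) * (z * l 2) * (z * l 3) = z ^ 4 * (l 0 * l 1 * l 2 * l 3) := by ring
    rw [e, hz, Complex.star_def, Complex.conj_mul', norm_mul, norm_mul, norm_mul, hn, hn, hn, hn]
    simp

theorem normSq_pauliCoeff_smul (l : Fin 4 → ℂ) {z : ℂ} (hz : star z * z = 1) (j : Fin 4) :
    Complex.normSq (pauliCoeff (z • l) j) = Complex.normSq (pauliCoeff l j) := by
  have h : pauliCoeff (z • l) j = z * pauliCoeff l j := by
    fin_cases j <;> simp [pauliCoeff] <;> ring
  have hz' : Complex.normSq z = 1 := by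
    apply Complex.ofReal_injective
    rw [Complex.normSq_eq_conj_mul_self]
    simpa using hz
  rw [h, Complex.normSq_mul, hz', one_mul]

theorem locallyEquivalent_magicDiag_of_normSq_eq_of_prod {l m : Fin 4 → ℂ}
    (hl : ∀ k, star (l k) * l k = 1) (hm : ∀ k, star (m k) * m k = 1)
    (hl' : l 0 * l 1 * l 2 * l 3 = 1) (hm' : m 0 * m 1 * m 2 * m 3 = 1)
    (h : ∀ j, Complex.normSq (pauliCoeff m j) = Complex.normSq (pauliCoeff l j))
    (h0 : ∀ j, j ≠ 0 → Complex.normSq (pauliCoeff l j) < Complex.normSq (pauliCoeff l 0)) :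
    LocallyEquivalent (magicDiag m) (magicDiag l) ∨
      LocallyEquivalent (magicDiag m) (magicDiag (star l)) := by
  obtain ⟨a1, a2, a3⟩ := re_mul_re_eq_normSq_pauliCoeff hl hl'
  obtain ⟨b1, b2, b3⟩ := re_mul_re_eq_normSq_pauliCoeff hm hm'
  have c1 := h0 1 (by decide)
  have c2 := h0 2 (by decide)
  have c3 := h0 3 (by decide)
  rw [h, h, h, h] at b1 b2 b3
  have hu : (l 0 * l 1).re ≠ 0 := fun e => by rw [e] at a2 a3; linarith
  have hv : (l 0 * l 2).re ≠ 0 := fun e => by rw [e] at a1 a3; linarith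
  have hw : (l 0 * l 3).re ≠ 0 := fun e => by rw [e] at a1 a2; linarith
  rcases eq_or_eq_neg_of_mul_eq hu hv hw (b1.trans a1.symm) (b2.trans a2.symm) (b3.trans a3.symm)
    with ⟨h1, h2, h3⟩ | ⟨h1, h2, h3⟩
  · exact locallyEquivalent_magicDiag_of_re_eq hl hm hl' hm' h1 h2 h3
  · have hI : star Complex.I * Complex.I = 1 := by simp
    have hre : ∀ i j, ((Complex.I • m) i * (Complex.I • m) j).re = -(m i * m j).re := by
      intro i j
      simp
    have hlm := (locallyEquivalent_magicDiag_smul m hI).symm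
    refine Or.imp hlm.trans hlm.trans (locallyEquivalent_magicDiag_of_re_eq hl
      (star_smul_mul_smul_self hm hI) hl' ?_ ?_ ?_ ?_)
    · simp only [Pi.smul_apply, smul_eq_mul]
      linear_combination hm' + m 0 * m 1 * m 2 * m 3 * Complex.I_pow_four
    · rw [hre, h1, neg_neg]
    · rw [hre, h2, neg_neg]
    · rw [hre, h3, neg_neg]

theorem locallyEquivalent_magicDiag_of_normSq_eq {l m : Fin 4 → ℂ}
    (hl : ∀ k, star (l k) * l k = 1) (hm : ∀ k, star (m k) * m k = 1)
    (h : ∀ j, Complex.normSq (pauliCoeff m j) = Complex.normSq (pauliCoeff l j))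
    (h0 : ∀ j, j ≠ 0 → Complex.normSq (pauliCoeff l j) < Complex.normSq (pauliCoeff l 0)) :
    LocallyEquivalent (magicDiag m) (magicDiag l) ∨
      LocallyEquivalent (magicDiag m) (magicDiag (star l)) := by
  obtain ⟨z, hz, hzl⟩ := exists_unimodular_smul_prod_eq_one hl
  obtain ⟨w, hw, hwm⟩ := exists_unimodular_smul_prod_eq_one hm
  have hlz := locallyEquivalent_magicDiag_smul l hz
  have hlm := (locallyEquivalent_magicDiag_smul m hw).symm
  have hlz' := hlz.conj
  rw [magicDiag_map_conj, magicDiag_map_conj] at hlz'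
  refine Or.imp (fun h => (hlm.trans h).trans hlz) (fun h => (hlm.trans h).trans hlz')
    (locallyEquivalent_magicDiag_of_normSq_eq_of_prod (star_smul_mul_smul_self hl hz)
      (star_smul_mul_smul_self hm hw) hzl hwm (fun j => ?_) fun j hj => ?_)
  · rw [normSq_pauliCoeff_smul m hw, normSq_pauliCoeff_smul l hz, h]
  · rw [normSq_pauliCoeff_smul l hz, normSq_pauliCoeff_smul l hz]
    exact h0 j hj

/-- The Cartan decomposition, with the Pauli coefficients ordered as the Schmidt coefficients. -/
theorem HasSchmidtCoeffs.exists_locallyEquivalent_magicDiag {U : TwoQubitOp} {s : Fin 4 → ℝ}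
    (hU : U ∈ unitaryGroup (Fin 2 × Fin 2) ℂ) (hs : HasSchmidtCoeffs U s) :
    ∃ l : Fin 4 → ℂ, (∀ k, star (l k) * l k = 1) ∧ LocallyEquivalent U (magicDiag l) ∧
      ∀ j, Complex.normSq (pauliCoeff l j) = s j ^ 2 := by
  obtain ⟨l, hl, h⟩ := _root_.exists_locallyEquivalent_magicDiag U hU
  obtain ⟨σ, hσ⟩ := hs.complex.exists_perm
    ((hasComplexSchmidtCoeffs_magicDiag l).of_locallyEquivalent h)
  obtain ⟨m, hm, hml, hc⟩ := exists_locallyEquivalent_pauliCoeff_perm σ l hl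
  refine ⟨m, hm, h.trans hml.symm, fun j => ?_⟩
  have hsign : ∀ k, Complex.normSq ((![1, -1, 1, -1] : Fin 4 → ℂ) k) = 1 := fun k => by
    fin_cases k <;> simp
  rw [hc, pow_two, ← Complex.normSq_ofReal, hσ, Complex.normSq_mul, hsign, one_mul]

end

theorem corollary2 (U U' : TwoQubitOp)
    (hU : U ∈ Matrix.unitaryGroup (Fin 2 × Fin 2) ℂ)
    (hU' : U' ∈ Matrix.unitaryGroup (Fin 2 × Fin 2) ℂ)
    (s : Fin 4 → ℝ)
    (hs : HasSchmidtCoeffs U s) (hs' : HasSchmidtCoeffs U' s)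
    (h01 : s 0 > s 1) (h12 : s 1 ≥ s 2) (h23 : s 2 ≥ s 3) :
    LocallyEquivalent U' U ∨ LocallyEquivalent U' (U.map (starRingEnd ℂ)) := by
  obtain ⟨l, hl, hUl, hc⟩ := hs.exists_locallyEquivalent_magicDiag hU
  obtain ⟨m, hm, hUm, hc'⟩ := hs'.exists_locallyEquivalent_magicDiag hU'
  have hconj := hUl.conj
  rw [magicDiag_map_conj] at hconj
  refine Or.imp (fun h => (hUm.trans h).trans hUl.symm) (fun h => (hUm.trans h).trans hconj.symm)
    (locallyEquivalent_magicDiag_of_normSq_eq hl hm (fun j => by rw [hc, hc']) fun j hj => ?_)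
  have hlt : s j < s 0 := by
    fin_cases j
    · exact absurd rfl hj
    · exact h01
    · exact h12.trans_lt h01
    · exact (h23.trans h12).trans_lt h01
  rw [hc, hc]
  exact pow_lt_pow_left₀ hlt (hs.2.1 j) two_ne_zero
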